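/- For $\gamma>0$ let $S_\gamma=\{z\in\mathbb C:\operatorname{Re}z>0,\ |\arg z|<\gamma\}$. For an element $a$ of a complex Banach algebra (not necessarily unital) let $\rho(a)$ denote its spectral radius (computed after adjoining a unit). Let $0<\alpha<\pi/2$ and $0\le\beta<\alpha$. Let $\mu$ be a complex Borel measure supported on a compact subset of $\{z\in\mathbb C:\operatorname{Re}z>0,\ |\arg z|\le\beta\}\subset S_\alpha$, with $\int d\mu=0$. Let $f(z)=\int e^{-z\xi}\,d\mu(\xi)$ be its Fourier--Borel transform, and let $\widetilde f(z)=\overline{f(\overline z)}$, which is the Fourier--Borel transform of the measure $\widetilde\mu(E)=\overline{\mu(\overline E)}$. Let $(T(t))_{t\in S_\alpha}$ be an analytic semigroup in a complex Banach algebra, i.e. $T$ is complex-differentiable in norm on $S_\alpha$ and $T(s+t)=T(s)T(t)$ for $s,t\in S_\alpha$; write $T(t)=\exp(tA)$ with $A$ its generator. Suppose that $T$ is not quasinilpotent, i.e. $\rho(T(t))\neq0$ for some $t\in S_\alpha$. Let $\mathcal A$ be the closed subalgebra generated by $(T(t))_{t\in S_\alpha}$, let $\operatorname{rad}\mathcal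 A=\{a\in\mathcal A:\rho(a)=0\}$, and let $\pi:\mathcal A\to\mathcal A/\operatorname{rad}\mathcal A$ be the canonical surjection. For $u\in S_{\alpha-\beta}$ put $$f(-uA)=\int T(u\xi)\,d\mu(\xi),\qquad \widetilde f(-uA)=\int T(u\xi)\,d\widetilde\mu(\xi)$$ (Bochner integrals). If there exists $t_0>0$ such that $$\sup_{t\in S_{\alpha-\beta},\ |t|\le t_0}\rho\bigl(f(-tA)\,\widetilde f(-tA)\bigr)<\sup_{z\in S_{\alpha-\beta}}|f(z)|\,|\widetilde f(z)|,$$ then $\mathcal A/\operatorname{rad}\mathcal A$ is unital and the generator of $(\pi(T(t)))_{t\in S_\alpha}$ is bounded; that is, with $e$ the unit of $\mathcal A/\operatorname{rad}\mathcal A$, there is $u\in\mathcal A/\operatorname{rad}\mathcal A$ such that $\pi(T(t))=\exp(tu)=e+\sum_{k\ge1}(tu)^k/k!$ for every $t\in S_\alpha$. -/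

import Mathlib

open MeasureTheory
open scoped ENNReal NNReal ComplexConjugate

noncomputable section

/-- The open sector `S_α = {z ∈ ℂ : Re z > 0, |arg z| < α}`. -/
def sector (α : ℝ) : Set ℂ := {z | 0 < z.re ∧ |z.arg| < α}

/-- The part `{z ∈ ℂ : Re z > 0, |arg z| ≤ β}` of the right half-plane. -/
def closedSector (β : ℝ) : Set ℂ := {z | 0 < z.re ∧ |z.arg| ≤ β}

/-! ### Spectral radius and radical in a Banach algebra which need not have a unit -/

section Radical

/-- The spectral radius of an element of a complex algebra that need not be unital: the spectral
radius in the algebra obtained by adjoining a unit. -/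
def rho {A : Type*} [NonUnitalRing A] [Module ℂ A] [IsScalarTower ℂ A A] [SMulCommClass ℂ A A]
    (a : A) : ℝ≥0∞ :=
  spectralRadius ℂ (a : Unitization ℂ A)

variable (A : Type*) [NonUnitalNormedCommRing A] [NormedSpace ℂ A] [IsScalarTower ℂ A A]
  [SMulCommClass ℂ A A]

/-- The Banach algebra obtained by adjoining a unit to `A` is commutative. -/
abbrev unitizationNormedCommRing : NormedCommRing (WithLp 1 (Unitization ℂ A)) :=
  { (inferInstance : NormedRing (WithLp 1 (Unitization ℂ A))) with
    mul_comm := fun x y => by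
      apply (WithLp.unitizationAlgEquiv (A := A) (𝕜 := ℂ) ℂ).injective
      simp only [map_mul]
      exact mul_comm _ _ }

variable {A}

theorem rho_eq_zero_iff [CompleteSpace A] (a : A) :
    rho a = 0 ↔ ∀ χ : WithLp 1 (Unitization ℂ A) →ₐ[ℂ] ℂ,
      χ (WithLp.toLp 1 (a : Unitization ℂ A)) = 0 := by
  let := unitizationNormedCommRing A
  set b : WithLp 1 (Unitization ℂ A) := WithLp.toLp 1 (a : Unitization ℂ A) with hb
  have hsp : spectrum ℂ b = spectrum ℂ (a : Unitization ℂ A) :=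
    (AlgEquiv.spectrum_eq (WithLp.unitizationAlgEquiv (A := A) (𝕜 := ℂ) ℂ) b).symm
  have h0 : rho a = 0 ↔ ∀ k ∈ spectrum ℂ b, k = 0 := by
    rw [hsp]
    simp [rho, spectralRadius]
  rw [h0]
  constructor
  · intro h χ
    exact h _ (AlgHom.apply_mem_spectrum χ b)
  · intro h k hk
    obtain ⟨f, hf⟩ := WeakDual.CharacterSpace.mem_spectrum_iff_exists.mp hk
    rw [← hf]
    exact h (WeakDual.CharacterSpace.toAlgHom f)

variable (A) in
/-- The radical of a commutative complex Banach algebra `A`: the elements of spectral radius `0`. -/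
def rad [CompleteSpace A] : Submodule ℂ A where
  carrier := {a | rho a = 0}
  add_mem' := by
    intro a b ha hb
    simp only [Set.mem_ofPred_eq, rho_eq_zero_iff] at *
    intro χ
    simp [ha χ, hb χ]
  zero_mem' := by
    simp only [Set.mem_ofPred_eq, rho_eq_zero_iff]
    intro χ
    simp
  smul_mem' := by
    intro c a ha
    simp only [Set.mem_ofPred_eq, rho_eq_zero_iff] at *
    intro χ
    simp [ha χ]

theorem mem_rad [CompleteSpace A] {a : A} : a ∈ rad A ↔ rho a = 0 := Iff.rfl

theorem mul_mem_rad [CompleteSpace A] (a : A) {b : A} (hb : b ∈ rad A) : a * b ∈ rad A := by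
  rw [mem_rad, rho_eq_zero_iff] at *
  intro χ
  have : WithLp.toLp 1 ((a * b : A) : Unitization ℂ A)
      = WithLp.toLp 1 (a : Unitization ℂ A) * WithLp.toLp 1 (b : Unitization ℂ A) := by
    apply (WithLp.unitizationAlgEquiv (A := A) (𝕜 := ℂ) ℂ).injective
    rw [map_mul]
    exact Unitization.inr_mul ℂ a b
  rw [this, map_mul, hb χ, mul_zero]

instance isClosed_rad [CompleteSpace A] : IsClosed (rad A : Set A) := by
  have : (rad A : Set A) = ⋂ χ : WithLp 1 (Unitization ℂ A) →ₐ[ℂ] ℂ,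
      {a : A | χ (WithLp.toLp 1 (a : Unitization ℂ A)) = 0} := by
    ext a
    simp only [SetLike.mem_coe, mem_rad, rho_eq_zero_iff, Set.mem_iInter, Set.mem_ofPred_eq]
  rw [this]
  refine isClosed_iInter fun χ => isClosed_eq ?_ continuous_const
  exact (map_continuous χ).comp (WithLp.unitization_isometry_inr (𝕜 := ℂ) (A := A)).continuous

/-- The product on `A / rad A`. -/
instance [CompleteSpace A] : Mul (A ⧸ rad A) where
  mul := Quotient.map₂ (· * ·) (by
    intro a₁ a₂ ha b₁ b₂ hb
    have ha' : a₁ - a₂ ∈ rad A := (Submodule.quotientRel_def _).mp ha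
    have hb' : b₁ - b₂ ∈ rad A := (Submodule.quotientRel_def _).mp hb
    refine (Submodule.quotientRel_def _).mpr ?_
    have : a₁ * b₁ - a₂ * b₂ = b₁ * (a₁ - a₂) + a₂ * (b₁ - b₂) := by
      rw [mul_sub, mul_sub, mul_comm b₁ a₁, mul_comm b₁ a₂]; abel
    rw [this]
    exact (rad A).add_mem (mul_mem_rad _ ha') (mul_mem_rad _ hb'))

theorem mk_mul_mk [CompleteSpace A] (a b : A) :
    (Submodule.Quotient.mk a * Submodule.Quotient.mk b : A ⧸ rad A)
      = Submodule.Quotient.mk (a * b) := rfl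

/-- `A / rad A`, with the quotient norm, is a commutative normed algebra. -/
instance [CompleteSpace A] : NonUnitalNormedCommRing (A ⧸ rad A) where
  __ := (inferInstance : NormedAddCommGroup (A ⧸ rad A))
  mul := (· * ·)
  left_distrib := by
    rintro ⟨a⟩ ⟨b⟩ ⟨c⟩
    exact congrArg Submodule.Quotient.mk (mul_add a b c)
  right_distrib := by
    rintro ⟨a⟩ ⟨b⟩ ⟨c⟩
    exact congrArg Submodule.Quotient.mk (add_mul a b c)
  zero_mul := by
    rintro ⟨a⟩
    exact congrArg Submodule.Quotient.mk (zero_mul a)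
  mul_zero := by
    rintro ⟨a⟩
    exact congrArg Submodule.Quotient.mk (mul_zero a)
  mul_assoc := by
    rintro ⟨a⟩ ⟨b⟩ ⟨c⟩
    exact congrArg Submodule.Quotient.mk (mul_assoc a b c)
  mul_comm := by
    rintro ⟨a⟩ ⟨b⟩
    exact congrArg Submodule.Quotient.mk (mul_comm a b)
  norm_mul_le := by
    intro x y
    have key : ∀ ε : ℝ, 0 < ε → ‖x * y‖ ≤ (‖x‖ + ε) * (‖y‖ + ε) := by
      intro ε hε
      obtain ⟨a, rfl, ha⟩ := Submodule.Quotient.norm_mk_lt x hε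
      obtain ⟨b, rfl, hb⟩ := Submodule.Quotient.norm_mk_lt y hε
      rw [mk_mul_mk]
      calc _ ≤ ‖a * b‖ := Submodule.Quotient.norm_mk_le _ _
        _ ≤ ‖a‖ * ‖b‖ := norm_mul_le a b
        _ ≤ _ := by gcongr
    have hlim : Filter.Tendsto (fun ε : ℝ => (‖x‖ + ε) * (‖y‖ + ε)) (nhdsWithin 0 (Set.Ioi 0))
        (nhds ((‖x‖ + 0) * (‖y‖ + 0))) := by
      apply Filter.Tendsto.mono_left _ nhdsWithin_le_nhds
      exact (by fun_prop : Continuous fun ε : ℝ => (‖x‖ + ε) * (‖y‖ + ε)).tendsto 0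
    have := ge_of_tendsto hlim (Filter.eventually_of_mem self_mem_nhdsWithin key)
    simpa using this

/-- `expTerm e v k` is `v ^ k / k!`, where `v ^ 0` is read as the unit `e`. -/
def expTerm {Q : Type*} [NonUnitalNormedCommRing Q] [NormedSpace ℂ Q] (e v : Q) : ℕ → Q
  | 0 => e
  | k + 1 => ((k + 1 : ℂ)⁻¹) • (v * expTerm e v k)

/-- A family `S` indexed by the sector `S_α`, in an algebra with unit `e`, has the bounded
generator `u`: `S t = exp (t u) = e + ∑_{k ≥ 1} (t u) ^ k / k!` for all `t`. -/
def HasBoundedGenerator {Q : Type*} [NonUnitalNormedCommRing Q] [NormedSpace ℂ Q] (e : Q) {α : ℝ}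
    (S : sector α → Q) : Prop :=
  ∃ u : Q, ∀ t : sector α, HasSum (expTerm e ((t : ℂ) • u)) (S t)

end Radical

/-! ### Analytic semigroups in a Banach algebra -/

section Semigroup

/-- An analytic semigroup `(T(t))_{t ∈ S_α}` in a complex normed algebra `B`. Only the values on the
sector `S_α` are relevant. -/
structure AnalyticSemigroup (α : ℝ) (B : Type*) [NonUnitalNormedRing B] [NormedSpace ℂ B] where
  toFun : ℂ → B
  differentiableOn : DifferentiableOn ℂ toFun (sector α)
  map_add : ∀ s ∈ sector α, ∀ t ∈ sector α, toFun (s + t) = toFun s * toFun t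

namespace AnalyticSemigroup

variable {α : ℝ} {B : Type*} [NonUnitalNormedRing B] [NormedSpace ℂ B]

instance : CoeFun (AnalyticSemigroup α B) (fun _ => ℂ → B) := ⟨toFun⟩

variable [IsScalarTower ℂ B B] [SMulCommClass ℂ B B] (T : AnalyticSemigroup α B)

/-- The semigroup is quasinilpotent: all its elements have spectral radius `0`. -/
def IsQuasinilpotent : Prop := ∀ t ∈ sector α, rho (T t) = 0

/-- The closed subalgebra of `B` generated by the semigroup. -/
def algebra : NonUnitalSubalgebra ℂ B :=
  (NonUnitalAlgebra.adjoin ℂ (T '' sector α)).topologicalClosure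

theorem algebra_mul_comm (x y : T.algebra) : x * y = y * x := by
  have hc : ∀ a ∈ T '' sector α, ∀ b ∈ T '' sector α, a * b = b * a := by
    rintro _ ⟨s, hs, rfl⟩ _ ⟨t, ht, rfl⟩
    rw [← T.map_add s hs t ht, ← T.map_add t ht s hs, add_comm]
  have := NonUnitalAlgebra.isMulCommutative_adjoin ℂ hc
  let := NonUnitalSubalgebra.nonUnitalCommRingTopologicalClosure
    (NonUnitalAlgebra.adjoin ℂ (T '' sector α)) (fun a b => mul_comm' a b)
  exact mul_comm (G := (NonUnitalAlgebra.adjoin ℂ (T '' sector α)).topologicalClosure) x y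

instance : NonUnitalNormedCommRing T.algebra :=
  { (inferInstance : NonUnitalNormedRing T.algebra) with mul_comm := T.algebra_mul_comm }

instance : NormedSpace ℂ T.algebra where
  norm_smul_le c x := norm_smul_le c (x : B)

instance [CompleteSpace B] : CompleteSpace T.algebra :=
  (NonUnitalSubalgebra.isClosed_topologicalClosure _).completeSpace_coe

/-- The element `T(t)` of the closed algebra generated by the semigroup. -/
def toAlgebra (t : sector α) : T.algebra :=
  ⟨T t, NonUnitalSubalgebra.le_topologicalClosure _
    (NonUnitalAlgebra.subset_adjoin ℂ ⟨t, t.2, rfl⟩)⟩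

end AnalyticSemigroup

end Semigroup

/-! ### Measures, Fourier--Borel transforms and functional calculus -/

section Calculus

/-- The integral of a vector-valued function against a complex measure. -/
def cintegral {B : Type*} [NormedAddCommGroup B] [NormedSpace ℂ B] (μ : ComplexMeasure ℂ)
    (g : ℂ → B) : B :=
  VectorMeasure.integral μ g (ContinuousLinearMap.lsmul ℝ ℂ).flip

/-- The Fourier--Borel transform `z ↦ ∫ exp (-z ξ) dμ(ξ)`. -/
def fourierBorel (μ : ComplexMeasure ℂ) (z : ℂ) : ℂ := cintegral μ fun ξ => Complex.exp (-z * ξ)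

/-- The complex measure `S ↦ conj (μ (conj S))`. -/
def conjMeasure (μ : ComplexMeasure ℂ) : ComplexMeasure ℂ :=
  (μ.map (fun z => conj z)).mapRange (starRingEnd ℂ : ℂ →+* ℂ).toAddMonoidHom
    Complex.continuous_conj

theorem conjMeasure_apply (μ : ComplexMeasure ℂ) {S : Set ℂ} (hS : MeasurableSet S) :
    conjMeasure μ S = conj (μ ((fun z => conj z) ⁻¹' S)) := by
  simp [conjMeasure, VectorMeasure.map_apply _ (Complex.continuous_conj.measurable) hS]

/-- The functional calculus `f(-uA) = ∫ T(u ξ) dμ(ξ)`, where `f` is the Fourier--Borel transform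
of `μ` and `A` is the generator of the semigroup `T`. -/
def functionalCalculus {α : ℝ} {B : Type*} [NonUnitalNormedRing B] [NormedSpace ℂ B]
    (T : AnalyticSemigroup α B) (μ : ComplexMeasure ℂ) (u : ℂ) : B :=
  cintegral μ fun ξ => T (u * ξ)

end Calculus

end

/-! Put `F = f · f~`. A character of the algebra `𝒜` (generated by `T`) with a unit adjoined either
vanishes on `𝒜` or sends `T(t)` to `exp(-l t)` for some complex `l`. It then sends `f(-tA)` to `f(l
t)`, so `|F(l t)|` is at most the spectral radius in the hypothesis, for all small `t` in `S_{α-β}`.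
The heart of the proof is that the set `Λ` of these exponents `l` is bounded
(`exists_norm_le_of_small_values`).

Characters are contractive, so `Re(l t) ≥ -log ‖T(t)‖` on `Λ`. If `Λ` were unbounded, some `l_n → ∞`
would have directions converging to a unit `ω` with `Re(ω t) ≥ 0` on `S_α`, that is `|arg ω| ≤ π/2 -
α`. Let `z₀` be a point of `S_{α-β}` where `|F|` exceeds the supremum `C` over small `t`. Some `t`
in `S_{α-β}` turns `ω` to an angle of modulus `|arg ω| + |arg z₀| < π/2 - β`. In the sector `|arg z|
< π/2 - β`, `F` is bounded, and `|F|` is invariant under conjugation, so by Phragmén–Lindelöf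
(`exists_lt_norm_on_ray`) `|F|` exceeds `C` somewhere on that ray; rescale `t` so that `|F(ω t)| >
C`. Now `t/|l_n|` is eventually small while `F(l_n t/|l_n|) → F(ω t)`, a contradiction.

Once `Λ` is bounded, for small `τ > 0` the values of characters at `T(τ)` are either `0` or close to
`1`. The Riesz functional calculus (`exists_characterRestrict_eq_comp`) gives elements of `𝒜` that
become, modulo the radical, the unit and the generator `τ⁻¹ log T(τ)`. -/

noncomputable section

/-! ### Geometry of sectors -/

theorem mem_sector_iff {α : ℝ} (hα' : α < Real.pi / 2) {z : ℂ} :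
    z ∈ sector α ↔ z ≠ 0 ∧ |z.arg| < α := by
  constructor
  · rintro ⟨h, h'⟩
    exact ⟨fun h0 => by simp [h0] at h, h'⟩
  · rintro ⟨h, h'⟩
    exact ⟨(Complex.abs_arg_lt_pi_div_two_iff.mp (h'.trans hα')).resolve_right h, h'⟩

theorem exp_mem_sector {α : ℝ} (hα' : α < Real.pi / 2) {w : ℂ} (hw : |w.im| < α) :
    Complex.exp w ∈ sector α := by
  have hpi := Real.pi_pos
  rw [mem_sector_iff hα']
  refine ⟨Complex.exp_ne_zero w, ?_⟩
  have := abs_lt.mp hw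
  rwa [← Complex.log_im, Complex.log_exp (by linarith) (by linarith)]

/-- In this Cartesian form, openness and stability under addition are immediate. -/
theorem mem_sector_iff_abs_im_lt {α : ℝ} (hα : 0 < α) (hα' : α < Real.pi / 2) {z : ℂ} :
    z ∈ sector α ↔ |z.im| < Real.tan α * z.re := by
  have htan : 0 < Real.tan α := Real.tan_pos_of_pos_of_lt_pi_div_two hα hα'
  have key : 0 < z.re → (|z.arg| < α ↔ |z.im| < Real.tan α * z.re) := by
    intro hre
    have harg : |z.arg| < Real.pi / 2 := Complex.abs_arg_lt_pi_div_two_iff.mpr (Or.inl hre)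
    have h1 := abs_lt.mp harg
    have hm : ∀ x ∈ Set.Ioo (-(Real.pi / 2)) (Real.pi / 2),
        ∀ y ∈ Set.Ioo (-(Real.pi / 2)) (Real.pi / 2), (Real.tan x < Real.tan y ↔ x < y) :=
      fun x hx y hy => Real.strictMonoOn_tan.lt_iff_lt hx hy
    rw [abs_lt, abs_lt, ← hm (-α) ⟨by linarith, by linarith⟩ _ h1,
      ← hm _ h1 α ⟨by linarith, by linarith⟩, Real.tan_neg, Complex.tan_arg, lt_div_iff₀ hre,
      div_lt_iff₀ hre, neg_mul]
  constructor
  · rintro ⟨h, h'⟩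
    exact (key h).mp h'
  · intro h
    have hre : 0 < z.re := by
      by_contra hre
      nlinarith [abs_nonneg z.im]
    exact ⟨hre, (key hre).mpr h⟩

theorem isOpen_sector {α : ℝ} (hα : 0 < α) (hα' : α < Real.pi / 2) : IsOpen (sector α) := by
  have : sector α = {z : ℂ | |z.im| < Real.tan α * z.re} :=
    Set.ext fun z => mem_sector_iff_abs_im_lt hα hα'
  rw [this]
  exact isOpen_lt (by fun_prop) (by fun_prop)

theorem smul_mem_sector {α r : ℝ} (hr : 0 < r) {z : ℂ} (hz : z ∈ sector α) :
    (r : ℂ) * z ∈ sector α := by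
  refine ⟨by simpa using mul_pos hr hz.1, ?_⟩
  rw [Complex.arg_real_mul z hr]
  exact hz.2

theorem add_mem_sector {α : ℝ} (hα : 0 < α) (hα' : α < Real.pi / 2) {s t : ℂ}
    (hs : s ∈ sector α) (ht : t ∈ sector α) : s + t ∈ sector α := by
  rw [mem_sector_iff_abs_im_lt hα hα'] at *
  calc _ ≤ |s.im| + |t.im| := by simpa using abs_add_le s.im t.im
    _ < _ := by simp only [Complex.add_re]; linarith

theorem convex_sector {α : ℝ} (hα : 0 < α) (hα' : α < Real.pi / 2) : Convex ℝ (sector α) := by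
  rw [convex_iff_forall_pos]
  intro x hx y hy a b ha hb _
  simpa using add_mem_sector hα hα' (smul_mem_sector ha hx) (smul_mem_sector hb hy)

theorem ofReal_mem_sector {α r : ℝ} (hα : 0 < α) (hr : 0 < r) : (r : ℂ) ∈ sector α :=
  ⟨by simpa using hr, by simpa [Complex.arg_ofReal_of_nonneg hr.le] using hα⟩

theorem conj_mem_sector {α : ℝ} {z : ℂ} (hz : z ∈ sector α) : conj z ∈ sector α := by
  refine ⟨by simpa using hz.1, ?_⟩
  have harg : z.arg ≠ Real.pi := fun h => by
    have := Complex.arg_eq_pi_iff.mp h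
    linarith [hz.1]
  rw [Complex.arg_conj, if_neg harg, abs_neg]
  exact hz.2

theorem mul_mem_sector {α β : ℝ} (hα' : α < Real.pi / 2) {u ξ : ℂ} (hu : u ∈ sector (α - β))
    (hξ : ξ ∈ closedSector β) : u * ξ ∈ sector α := by
  have hpi := Real.pi_pos
  have hu0 : u ≠ 0 := fun h => by simpa [h] using hu.1
  have hξ0 : ξ ≠ 0 := fun h => by simpa [h] using hξ.1
  have h1 := abs_lt.mp hu.2
  have h2 := abs_le.mp hξ.2
  rw [mem_sector_iff hα', Complex.arg_mul hu0 hξ0 ⟨by linarith, by linarith⟩]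
  exact ⟨mul_ne_zero hu0 hξ0, abs_lt.mpr ⟨by linarith, by linarith⟩⟩

/-! ### Integration against complex measures -/

/-- The variation is dominated by the sum of the total variations of the real and imaginary parts,
which are finite. -/
instance ComplexMeasure.isFiniteMeasure_variation {X : Type*} [MeasurableSpace X]
    (μ : ComplexMeasure X) : IsFiniteMeasure μ.variation := by
  refine isFiniteMeasure_of_le ((ComplexMeasure.re μ).totalVariation +
    (ComplexMeasure.im μ).totalVariation) ?_
  refine VectorMeasure.variation_le_of_forall_enorm_le fun E _ => ?_
  have hre := SignedMeasure.enorm_le_totalVariation (ComplexMeasure.re μ) E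
  have him := SignedMeasure.enorm_le_totalVariation (ComplexMeasure.im μ) E
  calc ‖μ E‖ₑ = ‖((μ E).re : ℂ) + ((μ E).im : ℂ) * Complex.I‖ₑ := by rw [Complex.re_add_im]
    _ ≤ ‖((μ E).re : ℂ)‖ₑ + ‖((μ E).im : ℂ) * Complex.I‖ₑ := enorm_add_le _ _
    _ = ‖(μ E).re‖ₑ + ‖(μ E).im‖ₑ := by simp [← ofReal_norm]
    _ ≤ _ := add_le_add hre him

/-- Checked on indicators and extended by density in `L¹`. Allowing a second measure `ν` serves two
cases: bounded complex-linear maps with `ν = μ`, and conjugation, which also changes the measure. -/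
theorem VectorMeasure.comp_integral {X E F G F' E' G' : Type*} [MeasurableSpace X]
    [NormedAddCommGroup E] [NormedSpace ℝ E] [NormedAddCommGroup F] [NormedSpace ℝ F]
    [NormedAddCommGroup G] [NormedSpace ℝ G] [NormedAddCommGroup E'] [NormedSpace ℝ E']
    [NormedAddCommGroup F'] [NormedSpace ℝ F'] [NormedAddCommGroup G'] [NormedSpace ℝ G']
    [CompleteSpace G] [CompleteSpace G']
    {μ : VectorMeasure X F} {ν : VectorMeasure X F'} {P : E →L[ℝ] F →L[ℝ] G}
    {P' : E' →L[ℝ] F' →L[ℝ] G'} (L : G →L[ℝ] G') (L' : E →L[ℝ] E')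
    (hν : ν.variation ≤ μ.variation)
    (h : ∀ s, MeasurableSet s → ∀ x, L (P x (μ s)) = P' (L' x) (ν s))
    {f : X → E} (hf : μ.Integrable f) :
    L (μ.integral f P) = ν.integral (fun x => L' (f x)) P' := by
  have hint : ∀ {g : X → E}, μ.Integrable g → ν.Integrable fun x => L' (g x) := fun hg =>
    (L'.integrable_comp hg).mono_measure hν
  refine Integrable.induction (P := fun f => L (μ.integral f P) =
    ν.integral (fun x => L' (f x)) P') ?_ ?_ ?_ ?_ hf
  · intro c s hs hsf
    have h1 : μ.integral (s.indicator fun _ => c) P = P c (μ s) := by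
      rw [VectorMeasure.integral_eq_setToFun, setToFun_indicator_const _ hs hsf.ne]
      rfl
    have h2 : (fun x => L' (s.indicator (fun _ => c) x)) = s.indicator fun _ => L' c := by
      ext x
      by_cases hx : x ∈ s <;> simp [hx]
    have h3 : ν.integral (s.indicator fun _ => L' c) P' = P' (L' c) (ν s) := by
      rw [VectorMeasure.integral_eq_setToFun,
        setToFun_indicator_const _ hs ((hν s).trans_lt hsf).ne]
      rfl
    rw [h1, h2, h3, h s hs]
  · intro f g _ hf hg hf' hg'
    rw [VectorMeasure.integral_add hf hg, map_add, hf', hg']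
    rw [← VectorMeasure.integral_fun_add (hint hf) (hint hg)]
    simp
  · refine isClosed_eq (L.continuous.comp VectorMeasure.continuous_integral) ?_
    rw [continuous_iff_continuousAt]
    intro g
    refine VectorMeasure.tendsto_integral_of_L1 _ (hint (L1.integrable_coeFn g)).1
      (Filter.Eventually.of_forall fun i => hint (L1.integrable_coeFn i)) ?_
    have h0 : Filter.Tendsto (fun i : X →₁[μ.variation] E => ‖L'‖ₑ * edist i g) (nhds g)
        (nhds 0) := by
      have : Filter.Tendsto (fun i : X →₁[μ.variation] E => edist i g) (nhds g) (nhds 0) :=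
        tendsto_iff_edist_tendsto_0.mp Filter.tendsto_id
      simpa using ENNReal.Tendsto.const_mul this (Or.inr enorm_ne_top)
    refine tendsto_of_tendsto_of_tendsto_of_le_of_le tendsto_const_nhds h0
      (fun _ => zero_le) fun i => ?_
    calc ∫⁻ x, ‖L' (i x) - L' (g x)‖ₑ ∂ν.variation
        ≤ ∫⁻ x, ‖L' (i x) - L' (g x)‖ₑ ∂μ.variation := lintegral_mono' hν le_rfl
      _ ≤ ∫⁻ x, ‖L'‖ₑ * edist (i x) (g x) ∂μ.variation := by
          refine lintegral_mono fun x => ?_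
          rw [← map_sub, edist_eq_enorm_sub]
          exact L'.le_opENorm _
      _ = ‖L'‖ₑ * edist i g := by
          rw [lintegral_const_mul' _ _ enorm_ne_top, L1.edist_def]
  · intro f g hfg _ hf'
    rw [← VectorMeasure.integral_congr_ae hfg, hf']
    refine VectorMeasure.integral_congr_ae ?_
    filter_upwards [Measure.absolutelyContinuous_of_le hν hfg] with x hx
    rw [hx]

theorem map_cintegral {E E' : Type*} [NormedAddCommGroup E] [NormedSpace ℂ E]
    [NormedAddCommGroup E'] [NormedSpace ℂ E'] [CompleteSpace E] [CompleteSpace E']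
    (μ : ComplexMeasure ℂ) (L : E →L[ℂ] E') {g : ℂ → E} (hg : μ.Integrable g) :
    L (cintegral μ g) = cintegral μ fun ξ => L (g ξ) :=
  VectorMeasure.comp_integral (L.restrictScalars ℝ) (L.restrictScalars ℝ) le_rfl
    (fun s _ x => by simp) hg

theorem variation_compl_eq_zero {μ : ComplexMeasure ℂ} {K : Set ℂ} (hK : IsCompact K)
    (hμK : ∀ E : Set ℂ, MeasurableSet E → Disjoint E K → μ E = 0) : μ.variation Kᶜ = 0 := by
  rw [VectorMeasure.variation_apply_eq_zero hK.measurableSet.compl]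
  exact fun t ht hm => hμK t hm (Set.disjoint_left.mpr fun x hx => ht hx)

theorem ae_mem_of_support {μ : ComplexMeasure ℂ} {K : Set ℂ} (hK : IsCompact K)
    (hμK : ∀ E : Set ℂ, MeasurableSet E → Disjoint E K → μ E = 0) :
    ∀ᵐ ξ ∂μ.variation, ξ ∈ K := by
  rw [ae_iff]
  exact variation_compl_eq_zero hK hμK

theorem integrable_of_continuousOn {E : Type*} [NormedAddCommGroup E] {μ : ComplexMeasure ℂ}
    {K : Set ℂ} (hK : IsCompact K)
    (hμK : ∀ E : Set ℂ, MeasurableSet E → Disjoint E K → μ E = 0) {g : ℂ → E}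
    (hg : ContinuousOn g K) : μ.Integrable g := by
  have := hg.integrableOn_compact (μ := μ.variation) hK
  rwa [IntegrableOn, Measure.restrict_eq_self_of_ae_mem (ae_mem_of_support hK hμK)] at this

theorem conjMeasure_support {μ : ComplexMeasure ℂ} {K : Set ℂ}
    (hμK : ∀ E : Set ℂ, MeasurableSet E → Disjoint E K → μ E = 0) (E : Set ℂ)
    (hE : MeasurableSet E) (hd : Disjoint E ((fun z => conj z) '' K)) :
    conjMeasure μ E = 0 := by
  rw [conjMeasure_apply μ hE, hμK _ (Complex.continuous_conj.measurable hE), map_zero]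
  refine Set.disjoint_left.mpr fun x hx hxK => ?_
  exact Set.disjoint_left.mp hd hx ⟨x, hxK, rfl⟩

/-- `conjMeasure` is a push-forward followed by conjugation of the values; the change of variables
handles the first and `VectorMeasure.comp_integral` the second. -/
theorem cintegral_conjMeasure {μ : ComplexMeasure ℂ} {K : Set ℂ} (hK : IsCompact K)
    (hμK : ∀ E : Set ℂ, MeasurableSet E → Disjoint E K → μ E = 0) {g : ℂ → ℂ}
    (hg : Continuous g) :
    cintegral (conjMeasure μ) g = conj (cintegral μ fun ξ => conj (g (conj ξ))) := by
  have hle : (conjMeasure μ).variation ≤ (μ.map fun z => conj z).variation := by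
    refine VectorMeasure.variation_le_of_forall_enorm_le fun E hE => ?_
    refine le_trans (le_of_eq ?_) (VectorMeasure.enorm_measure_le_variation _ E)
    simp [conjMeasure, enorm_eq_nnnorm]
  have hmeas : Measurable fun z : ℂ => conj z := Complex.continuous_conj.measurable
  have hi : μ.Integrable ((fun z => conj (g z)) ∘ fun z => conj z) :=
    integrable_of_continuousOn hK hμK (by fun_prop)
  have hsm : AEStronglyMeasurable (fun z => conj (g z)) (μ.variation.map fun z => conj z) :=
    Continuous.aestronglyMeasurable (by fun_prop)
  have h1 : cintegral (μ.map fun z => conj z) (fun z => conj (g z))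
      = cintegral μ fun ξ => conj (g (conj ξ)) := VectorMeasure.integral_map hmeas hsm hi
  rw [← h1]
  have h2 := VectorMeasure.comp_integral (μ := μ.map fun z => conj z) (ν := conjMeasure μ)
    (P := (ContinuousLinearMap.lsmul ℝ ℂ).flip) (P' := (ContinuousLinearMap.lsmul ℝ ℂ).flip)
    (Complex.conjCLE : ℂ →L[ℝ] ℂ) (Complex.conjCLE : ℂ →L[ℝ] ℂ) hle
    (fun s _ x => by simp [conjMeasure]) (VectorMeasure.Integrable.map hsm hi)
  simp only [ContinuousLinearEquiv.coe_coe, Complex.conjCLE_apply, Complex.conj_conj] at h2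
  exact h2.symm

/-! ### The Fourier--Borel transform -/

theorem fourierBorel_conjMeasure {μ : ComplexMeasure ℂ} {K : Set ℂ} (hK : IsCompact K)
    (hμK : ∀ E : Set ℂ, MeasurableSet E → Disjoint E K → μ E = 0) (z : ℂ) :
    fourierBorel (conjMeasure μ) z = conj (fourierBorel μ (conj z)) := by
  rw [fourierBorel, cintegral_conjMeasure hK hμK (by fun_prop)]
  congr 2
  ext ξ
  simp [← Complex.exp_conj]

/-- Differentiation under the integral: by the mean value inequality the difference quotients are
bounded uniformly on the compact support, so dominated convergence applies. -/
theorem differentiable_fourierBorel {μ : ComplexMeasure ℂ} {K : Set ℂ} (hK : IsCompact K)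
    (hμK : ∀ E : Set ℂ, MeasurableSet E → Disjoint E K → μ E = 0) :
    Differentiable ℂ (fourierBorel μ) := by
  intro z
  obtain ⟨R, hR⟩ := hK.isBounded.exists_norm_le
  have hint : ∀ w : ℂ, μ.Integrable fun ξ : ℂ => Complex.exp (-w * ξ) := fun w =>
    integrable_of_continuousOn hK hμK (by fun_prop)
  have hd : ∀ ξ w : ℂ, HasDerivAt (fun w : ℂ => Complex.exp (-w * ξ))
      (Complex.exp (-w * ξ) * (-1 * ξ)) w := fun ξ w =>
    (((hasDerivAt_id w).neg).mul_const ξ).cexp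
  refine HasDerivAt.differentiableAt (f' := cintegral μ fun ξ => Complex.exp (-z * ξ) * (-1 * ξ)) ?_
  rw [hasDerivAt_iff_tendsto_slope]
  have hslope : ∀ w, slope (fourierBorel μ) z w =
      cintegral μ fun ξ => slope (fun w : ℂ => Complex.exp (-w * ξ)) z w := by
    intro w
    have h1 := map_cintegral μ ((w - z)⁻¹ • ContinuousLinearMap.id ℂ ℂ) ((hint w).sub (hint z))
    have h2 : cintegral μ ((fun ξ : ℂ => Complex.exp (-w * ξ)) - fun ξ => Complex.exp (-z * ξ))
        = fourierBorel μ w - fourierBorel μ z := VectorMeasure.integral_sub (hint w) (hint z)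
    rw [h2] at h1
    simpa [slope_def_module] using h1
  simp_rw [funext hslope]
  refine VectorMeasure.tendsto_integral_filter_of_norm_le_const ?_ ?_ ?_
  · refine Filter.Eventually.of_forall fun w => ?_
    simp only [slope_def_module]
    exact Continuous.aestronglyMeasurable (by fun_prop)
  · refine ⟨Real.exp ((‖z‖ + 1) * R) * R, ?_⟩
    filter_upwards [nhdsWithin_le_nhds (Metric.closedBall_mem_nhds z one_pos)] with w hw
    filter_upwards [ae_mem_of_support hK hμK] with ξ hξ
    have hR0 : 0 ≤ R := (norm_nonneg ξ).trans (hR ξ hξ)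
    have hle : ∀ x ∈ Metric.closedBall z 1,
        ‖deriv (fun w : ℂ => Complex.exp (-w * ξ)) x‖ ≤ Real.exp ((‖z‖ + 1) * R) * R := by
      intro x hx
      rw [(hd ξ x).deriv, norm_mul]
      have hx' : ‖x‖ ≤ ‖z‖ + 1 := by
        have := norm_le_norm_add_norm_sub' x z
        rw [Metric.mem_closedBall, dist_eq_norm] at hx
        linarith
      have hxξ : ‖-x * ξ‖ ≤ (‖z‖ + 1) * R := by
        rw [norm_mul, norm_neg]
        exact mul_le_mul hx' (hR ξ hξ) (norm_nonneg _) (by positivity)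
      refine mul_le_mul ?_ (by simpa using hR ξ hξ) (norm_nonneg _) (Real.exp_nonneg _)
      exact (Complex.norm_exp_le_exp_norm _).trans (Real.exp_le_exp.mpr hxξ)
    have hmv := Convex.norm_image_sub_le_of_norm_deriv_le
      (fun x _ => (hd ξ x).differentiableAt) hle (convex_closedBall z 1)
      (Metric.mem_closedBall_self zero_le_one) hw
    rw [slope_def_module, norm_smul, norm_inv]
    rcases eq_or_ne w z with rfl | hne
    · simp only [sub_self, norm_zero, inv_zero, zero_mul]
      positivity
    · rw [inv_mul_le_iff₀ (norm_pos_iff.mpr (sub_ne_zero.mpr hne)), mul_comm ‖w - z‖]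
      exact hmv
  · exact Filter.Eventually.of_forall fun ξ => hasDerivAt_iff_tendsto_slope.mp (hd ξ z)

/-- Here `exp(w) ξ` stays in the right half-plane for `ξ ∈ K`, so the integrand has modulus at most
`1`. The logarithmic coordinate `w` turns sectors into strips, as Phragmén–Lindelöf needs. -/
theorem exists_norm_fourierBorel_le {β : ℝ} {μ : ComplexMeasure ℂ} {K : Set ℂ} (hK : IsCompact K)
    (hKβ : K ⊆ closedSector β)
    (hμK : ∀ E : Set ℂ, MeasurableSet E → Disjoint E K → μ E = 0) :
    ∃ M : ℝ, 0 ≤ M ∧ ∀ w : ℂ, |w.im| < Real.pi / 2 - β → ‖fourierBorel μ (Complex.exp w)‖ ≤ M := by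
  have hpi := Real.pi_pos
  set P : ℂ →L[ℝ] ℂ →L[ℝ] ℂ := (ContinuousLinearMap.lsmul ℝ ℂ).flip
  refine ⟨1 * ‖P‖ * μ.variation.real Set.univ, by positivity, fun w hw => ?_⟩
  refine VectorMeasure.norm_integral_le_of_norm_le_const ?_
  filter_upwards [ae_mem_of_support hK hμK] with ξ hξ
  have hξ' := hKβ hξ
  have h1 := abs_lt.mp hw
  have h2 := abs_le.mp hξ'.2
  have hξ0 : ξ ≠ 0 := fun h => by simpa [h] using hξ'.1
  have hm : Complex.exp (w + Complex.log ξ) ∈ sector (Real.pi / 2) := by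
    have him : |(w + Complex.log ξ).im| < Real.pi / 2 := by
      rw [Complex.add_im, Complex.log_im, abs_lt]
      constructor <;> linarith
    -- `exp_mem_sector` requires an angle strictly below `π/2`, so one takes the midpoint.
    set γ := (|(w + Complex.log ξ).im| + Real.pi / 2) / 2
    have := exp_mem_sector (α := γ) (w := w + Complex.log ξ) (by simp only [γ]; linarith)
      (by simp only [γ]; linarith)
    exact ⟨this.1, this.2.trans (by simp only [γ]; linarith)⟩
  rw [Complex.exp_add, Complex.exp_log hξ0] at hm
  rw [Complex.norm_exp, neg_mul, Complex.neg_re]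
  exact Real.exp_le_one_iff.mpr (by linarith [hm.1])

/-! ### A maximum principle for symmetric functions in sectors -/

/-- Along the rays which bound a sector, the supremum of an even function which is bounded in the
sector is at least as large as inside. -/
theorem exists_lt_norm_on_ray {H : ℂ → ℂ} (hH : Differentiable ℂ H)
    (hsymm : ∀ w, ‖H (conj w)‖ = ‖H w‖) {γ M : ℝ} (hM : ∀ w : ℂ, |w.im| < γ → ‖H w‖ ≤ M)
    {C ψ : ℝ} (hψγ : |ψ| < γ) {w₀ : ℂ} (hw₀ : |w₀.im| ≤ |ψ|) (hC : C < ‖H w₀‖) :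
    ∃ s : ℝ, C < ‖H (s + ψ * Complex.I)‖ := by
  by_contra! hcon
  refine absurd hC (not_lt.mpr ?_)
  -- By symmetry, a bound on one boundary line is a bound on both.
  have hray : ∀ z : ℂ, |z.im| = |ψ| → ‖H z‖ ≤ C := by
    intro z hz
    rcases abs_eq_abs.mp hz with h | h
    · have := hcon z.re
      rwa [← h, Complex.re_add_im] at this
    · have := hcon z.re
      have hz' : (z.re : ℂ) + ψ * Complex.I = conj z := by
        apply Complex.ext <;> simp [h]
      rwa [hz', hsymm] at this
  have h0 := abs_nonneg ψ
  refine PhragmenLindelof.horizontal_strip (a := -|ψ|) (b := |ψ|) hH.diffContOnCl ?_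
    (fun z hz => hray z (by rw [hz]; simp)) (fun z hz => hray z (by rw [hz]; simp))
    (abs_le.mp hw₀).1 (abs_le.mp hw₀).2
  -- The growth exponent is negative because for `ψ = 0` the strip has width `0` and `π / 0 = 0`.
  -- The coefficient `0` expresses boundedness.
  refine ⟨-1, lt_of_lt_of_le (by norm_num) (div_nonneg Real.pi_pos.le (by linarith)), 0, ?_⟩
  refine Asymptotics.IsBigO.of_bound M ?_
  refine Filter.eventually_of_mem (Filter.mem_inf_of_right (Filter.mem_principal_self _)) ?_
  intro z hz
  simpa using hM z ((abs_lt.mpr hz).trans hψγ)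

/-- This is duality of cones: the dual of a sector of half-angle `α` has half-angle `π/2 - α`. -/
theorem abs_arg_le_of_forall_re_nonneg {α : ℝ} (hα : 0 < α) (hα' : α < Real.pi / 2) {ω : ℂ}
    (hω : ‖ω‖ = 1) (h : ∀ t ∈ sector α, 0 ≤ (ω * t).re) : |ω.arg| ≤ Real.pi / 2 - α := by
  have hpi := Real.pi_pos
  have key : ∀ η : ℂ, ‖η‖ = 1 → (∀ t ∈ sector α, 0 ≤ (η * t).re) → η.arg ≤ Real.pi / 2 - α := by
    intro η hη h
    by_contra! hlt
    -- With this `φ`, the angle `arg η + φ` lies in `(π/2, 3π/2)`, where the cosine is negative; the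
    -- `max` with `0` keeps `φ > -α`.
    set φ : ℝ := (max (Real.pi / 2 - η.arg) 0 + α) / 2
    have h1 : Real.pi / 2 - η.arg ≤ max (Real.pi / 2 - η.arg) 0 := le_max_left _ _
    have h2 : 0 ≤ max (Real.pi / 2 - η.arg) 0 := le_max_right _ _
    have h3 : max (Real.pi / 2 - η.arg) 0 < α := max_lt (by linarith) hα
    have h4 := Complex.arg_le_pi η
    have hφ : |φ| < α := abs_lt.mpr ⟨by simp only [φ]; linarith, by simp only [φ]; linarith⟩
    have := h _ (exp_mem_sector hα' (w := φ * Complex.I) (by simpa using hφ))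
    have hη' : η = Complex.exp (η.arg * Complex.I) := by
      have := Complex.norm_mul_exp_arg_mul_I η
      rw [hη] at this
      simpa using this.symm
    rw [hη', ← Complex.exp_add, ← add_mul, ← Complex.ofReal_add, Complex.exp_ofReal_mul_I_re] at this
    have hneg := Real.cos_neg_of_pi_div_two_lt_of_lt (x := η.arg + φ)
      (by simp only [φ]; linarith) (by simp only [φ]; linarith)
    linarith
  by_cases hωpi : ω.arg = Real.pi
  · have := key ω hω h
    rw [hωpi] at this
    linarith
  refine abs_le.mpr ⟨?_, key ω hω h⟩
  have := key (conj ω) (by simpa using hω) fun t ht => by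
    have := h _ (conj_mem_sector ht)
    simp at this ⊢
    linarith
  rw [Complex.arg_conj, if_neg hωpi] at this
  linarith

/-- If `Re (l t)` is bounded below on `Λ` for each `t ∈ S_α`, and `F (l t)` is small for `l ∈ Λ` and
small `t` in `S_{α - β}`, compared with the supremum of `F` over `S_{α - β}`, then `Λ` is bounded. -/
theorem exists_norm_le_of_small_values {α β : ℝ} (hα : 0 < α) (hα' : α < Real.pi / 2)
    {F : ℂ → ℂ} (hF : Differentiable ℂ F) (hsymm : ∀ z, ‖F (conj z)‖ = ‖F z‖) {M : ℝ}
    (hM : ∀ w : ℂ, |w.im| < Real.pi / 2 - β → ‖F (Complex.exp w)‖ ≤ M)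
    {Λ : Set ℂ} (hΛ : ∀ t ∈ sector α, ∃ m : ℝ, ∀ l ∈ Λ, m ≤ (l * t).re)
    {C t₀ : ℝ} (ht₀ : 0 < t₀)
    (hC : ∀ t ∈ sector (α - β), ‖t‖ ≤ t₀ → ∀ l ∈ Λ, ‖F (l * t)‖ ≤ C)
    {z₀ : ℂ} (hz₀ : z₀ ∈ sector (α - β)) (hβ : 0 ≤ β) (hCz₀ : C < ‖F z₀‖) :
    ∃ R : ℝ, ∀ l ∈ Λ, ‖l‖ ≤ R := by
  have hpi := Real.pi_pos
  by_contra! hcon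
  choose l hlΛ hl using fun n : ℕ => hcon n
  have hl0 : ∀ n, 0 < ‖l n‖ := fun n => (Nat.cast_nonneg n).trans_lt (hl n)
  have hlim : Filter.Tendsto (fun n => ‖l n‖) Filter.atTop Filter.atTop :=
    Filter.tendsto_atTop_mono (fun n => (hl n).le) tendsto_natCast_atTop_atTop
  obtain ⟨ω, hω, ν, hν, hlimω⟩ := (isCompact_sphere (0 : ℂ) 1).tendsto_subseq
    (x := fun n => ((‖l n‖⁻¹ : ℝ) : ℂ) * l n) (fun n => by
      simp [(hl0 n).ne'])
  have hω1 : ‖ω‖ = 1 := by simpa using hω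
  have hlimν : Filter.Tendsto (fun n => ‖l (ν n)‖⁻¹) Filter.atTop (nhds 0) :=
    tendsto_inv_atTop_zero.comp (hlim.comp hν.tendsto_atTop)
  have harg : |ω.arg| ≤ Real.pi / 2 - α := by
    refine abs_arg_le_of_forall_re_nonneg hα hα' hω1 fun t ht => ?_
    obtain ⟨m, hm⟩ := hΛ t ht
    have h1 : Filter.Tendsto (fun n => ‖l (ν n)‖⁻¹ * m) Filter.atTop (nhds 0) := by
      simpa using hlimν.mul_const m
    have h2 : Filter.Tendsto (fun n => (((‖l (ν n)‖⁻¹ : ℝ) : ℂ) * l (ν n) * t).re) Filter.atTop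
        (nhds (ω * t).re) :=
      (Complex.continuous_re.tendsto _).comp (hlimω.mul_const t)
    refine le_of_tendsto_of_tendsto' h1 h2 fun n => ?_
    rw [mul_assoc, Complex.re_ofReal_mul]
    exact mul_le_mul_of_nonneg_left (hm _ (hlΛ _)) (inv_nonneg.mpr (norm_nonneg _))
  have hz₀0 : z₀ ≠ 0 := fun h => by simpa [h] using hz₀.1
  -- Turning `ω` away from the real axis by `|arg z₀|` puts the ray at least as far out as `z₀`, yet
  -- still inside the sector of half-angle `π/2 - β`.
  obtain ⟨φ, hφ, hφω⟩ : ∃ φ : ℝ, |φ| < α - β ∧ |ω.arg + φ| = |ω.arg| + |z₀.arg| := by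
    rcases le_total 0 ω.arg with h | h
    · refine ⟨|z₀.arg|, by simpa using hz₀.2, ?_⟩
      rw [abs_of_nonneg h, abs_of_nonneg (by positivity)]
    · refine ⟨-|z₀.arg|, by simpa using hz₀.2, ?_⟩
      rw [abs_of_nonpos h, abs_of_nonpos (by linarith [abs_nonneg z₀.arg])]
      ring
  obtain ⟨s, hs⟩ := exists_lt_norm_on_ray (H := fun w => F (Complex.exp w))
    (hF.comp Complex.differentiable_exp) (fun w => by rw [Complex.exp_conj, hsymm]) hM
    (C := C) (ψ := ω.arg + φ) (w₀ := Complex.log z₀)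
    (by rw [hφω]; linarith [hz₀.2]) (by rw [hφω, Complex.log_im]; linarith [abs_nonneg ω.arg])
    (by rwa [Complex.exp_log hz₀0])
  set t : ℂ := Complex.exp (s + φ * Complex.I)
  have ht : t ∈ sector (α - β) := exp_mem_sector (by linarith) (by simpa using hφ)
  have hωexp : ω = Complex.exp (ω.arg * Complex.I) := by
    have := Complex.norm_mul_exp_arg_mul_I ω
    rw [hω1] at this
    simpa using this.symm
  have hωt : Complex.exp (s + ((ω.arg + φ : ℝ) : ℂ) * Complex.I) = ω * t := by
    conv_rhs => rw [hωexp]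
    rw [← Complex.exp_add]
    congr 1
    push_cast
    ring
  rw [hωt] at hs
  have h3 : Filter.Tendsto (fun n => ‖F (((‖l (ν n)‖⁻¹ : ℝ) : ℂ) * l (ν n) * t)‖) Filter.atTop
      (nhds ‖F (ω * t)‖) :=
    ((hF.continuous.norm).tendsto _).comp (hlimω.mul_const t)
  have h4 : Filter.Tendsto (fun n => ‖l (ν n)‖⁻¹ * ‖t‖) Filter.atTop (nhds 0) := by
    simpa using hlimν.mul_const ‖t‖
  obtain ⟨n, hn, hn'⟩ := ((h3.eventually_const_lt hs).and (h4.eventually_le_const ht₀)).exists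
  have h5 := hC (((‖l (ν n)‖⁻¹ : ℝ) : ℂ) * t) (smul_mem_sector (inv_pos.mpr (hl0 _)) ht)
    (by simpa using hn') _ (hlΛ (ν n))
  rw [show l (ν n) * (((‖l (ν n)‖⁻¹ : ℝ) : ℂ) * t) = ((‖l (ν n)‖⁻¹ : ℝ) : ℂ) * l (ν n) * t by ring]
    at h5
  linarith

/-! ### Convergence of the exponential series -/

theorem summable_expTerm {Q : Type*} [NonUnitalNormedCommRing Q] [NormedSpace ℂ Q]
    [CompleteSpace Q] (e v : Q) : Summable (expTerm e v) := by
  have hb : ∀ k, ‖expTerm e v k‖ ≤ ‖e‖ * (‖v‖ ^ k / k.factorial) := by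
    intro k
    induction k with
    | zero => simp [expTerm]
    | succ k ih =>
      have hk : ‖((k + 1 : ℂ)⁻¹)‖ = ((k : ℝ) + 1)⁻¹ := by
        rw [norm_inv]
        norm_cast
      calc ‖expTerm e v (k + 1)‖ ≤ ((k : ℝ) + 1)⁻¹ * (‖v‖ * (‖e‖ * (‖v‖ ^ k / k.factorial))) := by
            rw [expTerm, norm_smul, hk]
            gcongr
            exact (norm_mul_le _ _).trans (by gcongr)
        _ = ‖e‖ * (‖v‖ ^ (k + 1) / (k + 1).factorial) := by
            rw [Nat.factorial_succ]
            push_cast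
            have : (k.factorial : ℝ) ≠ 0 := by positivity
            field_simp
            ring
  exact .of_norm_bounded ((Real.summable_pow_div_factorial ‖v‖).mul_left _) hb

/-! ### Characters of a commutative Banach algebra -/

section Characters

variable {A : Type*} [NonUnitalNormedCommRing A] [NormedSpace ℂ A] [IsScalarTower ℂ A A]
  [SMulCommClass ℂ A A]

theorem toLp_inr_mul (a b : A) : WithLp.toLp 1 ((a * b : A) : Unitization ℂ A)
    = WithLp.toLp 1 (a : Unitization ℂ A) * WithLp.toLp 1 (b : Unitization ℂ A) := by
  apply (WithLp.unitizationAlgEquiv (A := A) (𝕜 := ℂ) ℂ).injective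
  rw [map_mul]
  exact Unitization.inr_mul ℂ a b

variable (A) in
/-- The character of `A` with a unit adjoined that vanishes on `A`. -/
def characterAtInfinity : WithLp 1 (Unitization ℂ A) →ₐ[ℂ] ℂ :=
  (Unitization.fstHom ℂ A).comp (WithLp.unitizationAlgEquiv (A := A) (𝕜 := ℂ) ℂ).toAlgHom

theorem exists_eq_toLp_inr {y : WithLp 1 (Unitization ℂ A)} (hy : characterAtInfinity A y = 0) :
    ∃ b : A, WithLp.toLp 1 (b : Unitization ℂ A) = y := by
  refine ⟨y.ofLp.snd, ?_⟩
  apply WithLp.ofLp_injective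
  apply Unitization.ext
  · exact hy.symm
  · simp

theorem character_resolvent (χ : WithLp 1 (Unitization ℂ A) →ₐ[ℂ] ℂ)
    {x : WithLp 1 (Unitization ℂ A)} {z : ℂ}
    (hz : z ∈ resolventSet ℂ x) : χ (resolvent x z) = (z - χ x)⁻¹ := by
  have h := congrArg χ (Ring.inverse_mul_cancel _ hz)
  rw [map_mul, map_sub, AlgHom.commutes, map_one] at h
  exact eq_inv_of_mul_eq_one_left h

theorem norm_character_apply_le [CompleteSpace A] (χ : WithLp 1 (Unitization ℂ A) →ₐ[ℂ] ℂ)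
    (x : WithLp 1 (Unitization ℂ A)) : ‖χ x‖ ≤ ‖x‖ := by
  have h1 : ‖(1 : WithLp 1 (Unitization ℂ A))‖ = 1 := by
    change ‖WithLp.toLp 1 (1 : Unitization ℂ A)‖ = 1
    simp [WithLp.unitization_norm_def]
  simpa [h1] using AlgHom.norm_apply_le_self_mul_norm_one χ x

/-- The restriction to `A` of a character of the algebra obtained by adjoining a unit. -/
def characterRestrict [CompleteSpace A] (χ : WithLp 1 (Unitization ℂ A) →ₐ[ℂ] ℂ) : A →L[ℂ] ℂ :=
  LinearMap.mkContinuous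
    { toFun := fun a => χ (WithLp.toLp 1 (a : Unitization ℂ A))
      map_add' := fun a b => by simp
      map_smul' := fun c a => by simp } 1 fun a => by
    simpa [WithLp.unitization_norm_inr] using
      norm_character_apply_le χ (WithLp.toLp 1 (a : Unitization ℂ A))

variable [CompleteSpace A] (χ : WithLp 1 (Unitization ℂ A) →ₐ[ℂ] ℂ)

theorem characterRestrict_apply (a : A) :
    characterRestrict χ a = χ (WithLp.toLp 1 (a : Unitization ℂ A)) := rfl

theorem characterRestrict_mul (a b : A) :
    characterRestrict χ (a * b) = characterRestrict χ a * characterRestrict χ b := by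
  simp only [characterRestrict_apply, toLp_inr_mul, map_mul]

theorem norm_characterRestrict_apply_le (a : A) : ‖characterRestrict χ a‖ ≤ ‖a‖ := by
  simpa [WithLp.unitization_norm_inr, characterRestrict_apply] using
    norm_character_apply_le χ (WithLp.toLp 1 (a : Unitization ℂ A))

theorem mem_rad_iff {a : A} : a ∈ rad A ↔ ∀ χ, characterRestrict χ a = 0 :=
  (mem_rad (a := a)).trans (rho_eq_zero_iff a)

theorem exists_characterRestrict_eq_of_mem_spectrum {a : A} {z : ℂ}
    (hz : z ∈ spectrum ℂ (WithLp.toLp 1 (a : Unitization ℂ A))) :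
    ∃ χ, characterRestrict χ a = z := by
  let := unitizationNormedCommRing A
  obtain ⟨f, hf⟩ := WeakDual.CharacterSpace.mem_spectrum_iff_exists.mp hz
  exact ⟨WeakDual.CharacterSpace.toAlgHom f, hf⟩

theorem character_circleIntegral {c : ℂ} {R : ℝ} {F : ℂ → WithLp 1 (Unitization ℂ A)}
    (hF : CircleIntegrable F c R) : χ (∮ z in C(c, R), F z) = ∮ z in C(c, R), χ (F z) := by
  let L : WithLp 1 (Unitization ℂ A) →L[ℂ] ℂ :=
    χ.toLinearMap.mkContinuous 1 fun x => by simpa using norm_character_apply_le χ x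
  change L _ = _
  rw [circleIntegral, ← L.intervalIntegral_comp_comm hF.out]
  simp [circleIntegral, L]

/-- A form of the holomorphic functional calculus, for a function which is `0` near `0` and `g` near
`1`: the Riesz integral of `g` around `1`. -/
theorem exists_characterRestrict_eq_comp {a : A}
    (ha : ∀ χ, characterRestrict χ a = 0 ∨ ‖characterRestrict χ a - 1‖ ≤ 1 / 2) {g : ℂ → ℂ}
    (hg : DifferentiableOn ℂ g (Metric.ball 1 1)) :
    ∃ b : A, ∀ χ, (characterRestrict χ a = 0 → characterRestrict χ b = 0) ∧
      (‖characterRestrict χ a - 1‖ ≤ 1 / 2 →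
        characterRestrict χ b = g (characterRestrict χ a)) := by
  set x : WithLp 1 (Unitization ℂ A) := WithLp.toLp 1 (a : Unitization ℂ A) with hx
  -- Radius `3/4` encloses the part of the spectrum within `1/2` of `1`, leaves `0` outside, and
  -- stays where `g` is holomorphic.
  have hsub : Metric.closedBall (1 : ℂ) (3 / 4) ⊆ Metric.ball 1 1 :=
    Metric.closedBall_subset_ball (by norm_num)
  have hgd : ∀ z ∈ Metric.ball (1 : ℂ) 1, DifferentiableAt ℂ g z := fun z hz =>
    hg.differentiableAt (Metric.isOpen_ball.mem_nhds hz)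
  have hres : ∀ z ∈ Metric.sphere (1 : ℂ) (3 / 4), z ∈ resolventSet ℂ x := by
    intro z hz
    by_contra hcon
    obtain ⟨χ, hχ⟩ := exists_characterRestrict_eq_of_mem_spectrum (a := a) (z := z) hcon
    have hz' : ‖z - 1‖ = 3 / 4 := by simpa [dist_eq_norm] using hz
    rcases ha χ with h | h
    · rw [h] at hχ
      rw [← hχ] at hz'
      norm_num at hz'
    · rw [hχ, hz'] at h
      norm_num at h
  have hint : CircleIntegrable (fun z => g z • resolvent x z) 1 (3 / 4) := by
    refine ContinuousOn.circleIntegrable (by norm_num) fun z hz => ?_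
    refine ContinuousAt.continuousWithinAt (ContinuousAt.fun_smul ?_ ?_)
    · exact (hgd z (hsub (Metric.sphere_subset_closedBall hz))).continuousAt
    · exact (spectrum.hasDerivAt_resolvent_const_left (hres z hz)).continuousAt
  set y : WithLp 1 (Unitization ℂ A) :=
    (2 * Real.pi * Complex.I : ℂ)⁻¹ • ∮ z in C(1, 3 / 4), g z • resolvent x z with hy
  have hχy : ∀ χ : WithLp 1 (Unitization ℂ A) →ₐ[ℂ] ℂ,
      χ y = (2 * Real.pi * Complex.I : ℂ)⁻¹ * ∮ z in C(1, 3 / 4), (z - χ x)⁻¹ * g z := by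
    intro χ
    rw [hy, map_smul, character_circleIntegral χ hint, smul_eq_mul]
    congr 1
    refine circleIntegral.integral_congr (by norm_num) fun z hz => ?_
    simp only [map_smul, character_resolvent χ (hres z hz), smul_eq_mul, mul_comm]
  have hzero : ∀ χ : WithLp 1 (Unitization ℂ A) →ₐ[ℂ] ℂ, χ x = 0 → χ y = 0 := by
    intro χ h
    have hne : ∀ z ∈ Metric.ball (1 : ℂ) 1, z - 0 ≠ 0 := by
      rintro z hz h0
      rw [sub_zero] at h0
      simp [h0] at hz
    have hd : ∀ z ∈ Metric.ball (1 : ℂ) 1, DifferentiableAt ℂ (fun z => (z - 0)⁻¹ * g z) z :=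
      fun z hz => DifferentiableAt.fun_mul
        (DifferentiableAt.fun_inv (by fun_prop) (hne z hz)) (hgd z hz)
    rw [hχy, h, Complex.circleIntegral_eq_zero_of_differentiable_on_off_countable (by norm_num)
      Set.countable_empty (fun z hz => (hd z (hsub hz)).continuousAt.continuousWithinAt)
      (fun z hz => hd z (hsub (Metric.ball_subset_closedBall hz.1))), mul_zero]
  -- The character at infinity vanishes at `x`, hence at `y`: so the Riesz integral lies in `A`
  -- itself and not only in its unitization.
  obtain ⟨b, hb⟩ := exists_eq_toLp_inr (y := y) (hzero _ (by
    simp [characterAtInfinity, hx]))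
  refine ⟨b, fun χ => ⟨fun h => ?_, fun h => ?_⟩⟩
  · rw [characterRestrict_apply, hb]
    exact hzero χ h
  · rw [characterRestrict_apply, hb, hχy]
    have hw : χ x ∈ Metric.ball (1 : ℂ) (3 / 4) := by
      rw [Metric.mem_ball, dist_eq_norm]
      exact h.trans_lt (by norm_num)
    have := Complex.circleIntegral_sub_inv_smul_of_differentiable_on_off_countable
      Set.countable_empty hw (fun z hz => (hgd z (hsub hz)).continuousAt.continuousWithinAt)
      (fun z hz => hgd z (hsub (Metric.ball_subset_closedBall hz.1)))
    simp only [smul_eq_mul] at this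
    rw [this, inv_mul_cancel_left₀ Complex.two_pi_I_ne_zero]
    rfl

/-! ### Exponentials modulo the radical -/

theorem characterRestrict_expTerm (e v : A) (k : ℕ) :
    characterRestrict χ (expTerm e v k)
      = characterRestrict χ e * ((k.factorial : ℂ)⁻¹ * characterRestrict χ v ^ k) := by
  induction k with
  | zero => simp [expTerm]
  | succ k ih =>
    rw [expTerm, map_smul, characterRestrict_mul, ih, Nat.factorial_succ, smul_eq_mul, pow_succ]
    push_cast
    rw [mul_inv]
    ring

theorem mk_expTerm (e v : A) (k : ℕ) : (Submodule.Quotient.mk (expTerm e v k) : A ⧸ rad A)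
    = expTerm (Submodule.Quotient.mk e) (Submodule.Quotient.mk v) k := by
  induction k with
  | zero => rfl
  | succ k ih => rw [expTerm, expTerm, Submodule.Quotient.mk_smul, ← ih, mk_mul_mk]

/-- If all characters satisfy `χ(a) = χ(e) exp (χ(v))`, then `a` is the exponential of `v` modulo
the radical. -/
theorem hasSum_expTerm_mk {e v a : A}
    (h : ∀ χ, characterRestrict χ a
      = characterRestrict χ e * Complex.exp (characterRestrict χ v)) :
    HasSum (expTerm (Submodule.Quotient.mk e) (Submodule.Quotient.mk v))
      (Submodule.Quotient.mk a : A ⧸ rad A) := by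
  obtain ⟨y, hy⟩ := summable_expTerm e v
  have hya : (Submodule.Quotient.mk y : A ⧸ rad A) = Submodule.Quotient.mk a := by
    rw [Submodule.Quotient.eq, mem_rad_iff]
    intro χ
    have h1 : HasSum (fun k => characterRestrict χ (expTerm e v k)) (characterRestrict χ y) :=
      (characterRestrict χ).hasSum hy
    have h2 : HasSum (fun k => characterRestrict χ (expTerm e v k))
        (characterRestrict χ e * Complex.exp (characterRestrict χ v)) := by
      simp only [characterRestrict_expTerm]
      rw [Complex.exp_eq_exp_ℂ]
      exact (NormedSpace.exp_series_hasSum_exp' (𝕂 := ℂ) (characterRestrict χ v)).mul_left _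
    rw [map_sub, h1.unique h2, h χ, sub_self]
  have hc : Continuous fun x : A => (Submodule.Quotient.mk x : A ⧸ rad A) :=
    continuous_quot_mk
  have := hy.map (rad A).mkQ.toAddMonoidHom hc
  rw [← hya]
  refine this.congr_fun ?_
  intro k
  exact (mk_expTerm e v k).symm

end Characters

/-! ### Characters of the algebra generated by an analytic semigroup -/

/-- A scalar analytic semigroup on a sector is zero or an exponential. -/
theorem eq_zero_or_exists_eq_exp {α : ℝ} (hα : 0 < α) (hα' : α < Real.pi / 2) {h : ℂ → ℂ}
    (hd : DifferentiableOn ℂ h (sector α))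
    (hadd : ∀ s ∈ sector α, ∀ t ∈ sector α, h (s + t) = h s * h t) :
    (∀ t ∈ sector α, h t = 0) ∨ ∃ l : ℂ, ∀ t ∈ sector α, h t = Complex.exp (-l * t) := by
  have hopen := isOpen_sector hα hα'
  by_cases hz : ∃ t₀ ∈ sector α, h t₀ = 0
  · left
    obtain ⟨t₀, ht₀, h0⟩ := hz
    -- Since `h(2s) = h(s)²`, a zero at `t₀` gives zeros at `t₀/2ⁿ`; any `t` in the open sector is
    -- such a point plus another point of the sector.
    have hhalf : ∀ n : ℕ, ((2⁻¹ ^ n : ℝ) : ℂ) * t₀ ∈ sector α ∧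
        h (((2⁻¹ ^ n : ℝ) : ℂ) * t₀) = 0 := by
      intro n
      have hmem : ∀ n : ℕ, ((2⁻¹ ^ n : ℝ) : ℂ) * t₀ ∈ sector α := fun n =>
        smul_mem_sector (by positivity) ht₀
      induction n with
      | zero => simpa using ⟨ht₀, h0⟩
      | succ n ih =>
        refine ⟨hmem _, ?_⟩
        have := hadd _ (hmem (n + 1)) _ (hmem (n + 1))
        rw [← add_mul, ← Complex.ofReal_add,
          show (2⁻¹ : ℝ) ^ (n + 1) + 2⁻¹ ^ (n + 1) = 2⁻¹ ^ n by ring, ih.2] at this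
        exact mul_self_eq_zero.mp this.symm
    intro t ht
    have hlim : Filter.Tendsto (fun n : ℕ => t - ((2⁻¹ ^ n : ℝ) : ℂ) * t₀) Filter.atTop
        (nhds t) := by
      have h1 : Filter.Tendsto (fun n : ℕ => (2⁻¹ ^ n : ℝ)) Filter.atTop (nhds 0) :=
        tendsto_pow_atTop_nhds_zero_of_lt_one (by norm_num) (by norm_num)
      have h2 := (Complex.continuous_ofReal.tendsto 0).comp h1
      simpa using (h2.mul_const t₀).const_sub t
    obtain ⟨n, hn⟩ := (hlim.eventually_mem (hopen.mem_nhds ht)).exists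
    have := hadd _ hn _ (hhalf n).1
    rwa [sub_add_cancel, (hhalf n).2, mul_zero] at this
  · right
    push Not at hz
    have hdiff : ∀ t ∈ sector α, DifferentiableAt ℂ h t := fun t ht =>
      hd.differentiableAt (hopen.mem_nhds ht)
    have hderiv : ∀ s ∈ sector α, ∀ t ∈ sector α, deriv h (s + t) = deriv h s * h t := by
      intro s hs t ht
      have h1 : (fun s => h (s + t)) =ᶠ[nhds s] fun s => h s * h t :=
        Filter.eventually_of_mem (hopen.mem_nhds hs) fun s hs => hadd s hs t ht
      have h2 := h1.deriv_eq
      rwa [deriv_comp_add_const, deriv_mul_const (hdiff s hs)] at h2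
    have h1 : (1 : ℂ) ∈ sector α := by simpa using ofReal_mem_sector hα one_pos
    set l : ℂ := -(deriv h 1 / h 1) with hl
    -- Computing `h'(t + 1)` by differentiating either factor gives `h'(t) h(1) = h'(1) h(t)`.
    have hode : ∀ t ∈ sector α, deriv h t = -l * h t := by
      intro t ht
      have e1 := hderiv t ht 1 h1
      have e2 := hderiv 1 h1 t ht
      rw [add_comm 1 t, e1] at e2
      rw [hl, neg_neg, div_mul_eq_mul_div, eq_div_iff (hz 1 h1), e2]
    have hk : ∀ t ∈ sector α, HasDerivAt (fun t => h t * Complex.exp (l * t)) 0 t := by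
      intro t ht
      have e1 := (hdiff t ht).hasDerivAt.fun_mul
        (((hasDerivAt_id t).const_mul l).cexp)
      refine e1.congr_deriv ?_
      rw [hode t ht]
      simp
      ring
    have hconst : ∀ t ∈ sector α, h t * Complex.exp (l * t) = h 1 * Complex.exp (l * 1) := by
      intro t ht
      exact hopen.is_const_of_deriv_eq_zero (convex_sector hα hα').isPreconnected
        (fun s hs => (hk s hs).differentiableAt.differentiableWithinAt)
        (fun s hs => (hk s hs).deriv) ht h1
    -- The constant is nonzero and, by the semigroup law at `1 + 1`, equal to its square.
    have hone : h 1 * Complex.exp (l * 1) = 1 := by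
      have e1 := hconst _ (add_mem_sector hα hα' h1 h1)
      rw [hadd 1 h1 1 h1, mul_add, Complex.exp_add] at e1
      have hne : h 1 * Complex.exp (l * 1) ≠ 0 := mul_ne_zero (hz 1 h1) (Complex.exp_ne_zero _)
      refine mul_left_cancel₀ hne ?_
      linear_combination e1
    refine ⟨l, fun t ht => ?_⟩
    rw [neg_mul, Complex.exp_neg]
    exact eq_inv_of_mul_eq_one_left ((hconst t ht).trans hone)

theorem spectralRadius_toLp {B : Type*} [NonUnitalNormedRing B] [NormedSpace ℂ B]
    [IsScalarTower ℂ B B] [SMulCommClass ℂ B B] (x : Unitization ℂ B) :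
    spectralRadius ℂ (WithLp.toLp 1 x) = spectralRadius ℂ x := by
  have : spectrum ℂ (WithLp.toLp 1 x) = spectrum ℂ x :=
    (AlgEquiv.spectrum_eq (WithLp.unitizationAlgEquiv (A := B) (𝕜 := ℂ) ℂ) (WithLp.toLp 1 x)).symm
  simp only [spectralRadius, this]

namespace AnalyticSemigroup

variable {α : ℝ} {B : Type*} [NonUnitalNormedRing B] [NormedSpace ℂ B]
  (T : AnalyticSemigroup α B)

theorem continuousOn_comp_mul {β : ℝ} {K : Set ℂ} {u : ℂ} (hα' : α < Real.pi / 2)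
    (hKβ : K ⊆ closedSector β) (hu : u ∈ sector (α - β)) : ContinuousOn (fun ξ => T (u * ξ)) K :=
  T.differentiableOn.continuousOn.comp (by fun_prop) fun _ hξ => mul_mem_sector hα' hu (hKβ hξ)

variable [IsScalarTower ℂ B B] [SMulCommClass ℂ B B]

theorem toAlgebra_add (s t : sector α) (hst : (s + t : ℂ) ∈ sector α) :
    T.toAlgebra ⟨s + t, hst⟩ = T.toAlgebra s * T.toAlgebra t :=
  Subtype.ext (T.map_add s s.2 t t.2)

variable [CompleteSpace B]

/-- The spectral radius is taken in `B`, where `χ` need not extend to a character. Powers have the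
same norm in both algebras, so Gelfand's formula gives the bound. -/
theorem enorm_characterRestrict_le_rho (χ : WithLp 1 (Unitization ℂ T.algebra) →ₐ[ℂ] ℂ)
    (a : T.algebra) : ‖characterRestrict χ a‖ₑ ≤ rho (a : B) := by
  have hpow : ∀ n : ℕ, ∃ y : T.algebra,
      WithLp.toLp 1 (a : Unitization ℂ T.algebra) ^ (n + 1) = WithLp.toLp 1 (y : Unitization ℂ _) ∧
      WithLp.toLp 1 ((a : B) : Unitization ℂ B) ^ (n + 1)
        = WithLp.toLp 1 ((y : B) : Unitization ℂ B) := by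
    intro n
    induction n with
    | zero => exact ⟨a, by simp, by simp⟩
    | succ n ih =>
      obtain ⟨y, h1, h2⟩ := ih
      refine ⟨y * a, ?_, ?_⟩
      · rw [pow_succ, h1, toLp_inr_mul]
      · rw [pow_succ, h2]
        apply (WithLp.unitizationAlgEquiv (A := B) (𝕜 := ℂ) ℂ).injective
        rw [map_mul]
        exact (Unitization.inr_mul ℂ (y : B) (a : B)).symm
  have hlim := spectrum.pow_nnnorm_pow_one_div_tendsto_nhds_spectralRadius
    (WithLp.toLp 1 ((a : B) : Unitization ℂ B))
  rw [spectralRadius_toLp] at hlim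
  refine ge_of_tendsto hlim ?_
  filter_upwards [Filter.eventually_ge_atTop 1] with n hn
  obtain ⟨m, rfl⟩ : ∃ m, n = m + 1 := ⟨n - 1, by omega⟩
  obtain ⟨y, h1, h2⟩ := hpow m
  have hy : ‖characterRestrict χ a‖ ^ (m + 1) ≤ ‖(y : B)‖ := by
    rw [characterRestrict_apply, ← norm_pow, ← map_pow, h1]
    exact norm_characterRestrict_apply_le χ y
  have hn : ‖WithLp.toLp 1 ((a : B) : Unitization ℂ B) ^ (m + 1)‖₊ = ‖(y : B)‖₊ := by
    rw [h2]
    exact NNReal.eq (WithLp.unitization_norm_inr _)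
  rw [hn, one_div, ENNReal.le_rpow_inv_iff (by positivity), ENNReal.rpow_natCast]
  rw [enorm_eq_nnnorm, ← ENNReal.coe_pow, ENNReal.coe_le_coe, ← NNReal.coe_le_coe]
  simpa using hy

/-- Hahn–Banach. The semigroup is differentiable, and the integrals are formed, in `B`, so a
functional on `B` is needed; it need not be multiplicative. -/
theorem exists_extension_characterRestrict (χ : WithLp 1 (Unitization ℂ T.algebra) →ₐ[ℂ] ℂ) :
    ∃ G : B →L[ℂ] ℂ, ∀ a : T.algebra, G a = characterRestrict χ a := by
  let X : StrongDual ℂ T.algebra.toSubmodule :=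
    LinearMap.mkContinuous
      { toFun := fun x => characterRestrict χ (⟨x.1, x.2⟩ : T.algebra)
        map_add' := fun x y => (characterRestrict χ).map_add (⟨x.1, x.2⟩ : T.algebra) ⟨y.1, y.2⟩
        map_smul' := fun c x => (characterRestrict χ).map_smul c (⟨x.1, x.2⟩ : T.algebra) } 1 fun x =>
        (norm_characterRestrict_apply_le χ (⟨x.1, x.2⟩ : T.algebra)).trans_eq (one_mul _).symm
  obtain ⟨G, hG, -⟩ := exists_extension_norm_eq T.algebra.toSubmodule X
  exact ⟨G, fun a => hG ⟨a.1, a.2⟩⟩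

theorem characterRestrict_eq_zero_or_exists_eq_exp (hα : 0 < α) (hα' : α < Real.pi / 2)
    (χ : WithLp 1 (Unitization ℂ T.algebra) →ₐ[ℂ] ℂ) :
    (∀ a, characterRestrict χ a = 0) ∨
      ∃ l : ℂ, ∀ t : sector α, characterRestrict χ (T.toAlgebra t) = Complex.exp (-l * t) := by
  obtain ⟨G, hG⟩ := T.exists_extension_characterRestrict χ
  have hGT : ∀ t : sector α, G (T t) = characterRestrict χ (T.toAlgebra t) := fun t =>
    hG (T.toAlgebra t)
  rcases eq_zero_or_exists_eq_exp hα hα' (h := fun t => G (T t))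
    (G.differentiable.comp_differentiableOn T.differentiableOn) (fun s hs t ht => by
      have := hGT ⟨s + t, add_mem_sector hα hα' hs ht⟩
      rw [T.toAlgebra_add ⟨s, hs⟩ ⟨t, ht⟩, characterRestrict_mul, ← hGT, ← hGT] at this
      exact this) with h | ⟨l, h⟩
  · left
    have hadj : ∀ x (hx : x ∈ NonUnitalAlgebra.adjoin ℂ (T '' sector α)), G x = 0 := by
      have hle : ∀ {x}, x ∈ NonUnitalAlgebra.adjoin ℂ (T '' sector α) → x ∈ T.algebra := fun hx =>
        NonUnitalSubalgebra.le_topologicalClosure _ hx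
      intro x hx
      induction hx using NonUnitalAlgebra.adjoin_induction with
      | mem x hx =>
        obtain ⟨t, ht, rfl⟩ := hx
        exact h t ht
      | add x y _ _ hx hy => rw [_root_.map_add, hx, hy, add_zero]
      | zero => exact map_zero G
      | mul x y hxm hym hx hy =>
        have := hG (⟨x, hle hxm⟩ * ⟨y, hle hym⟩)
        rw [characterRestrict_mul, ← hG, hx, zero_mul] at this
        exact this
      | smul c x _ hx => rw [map_smul, hx, smul_zero]
    intro a
    rw [← hG]
    have hcl : IsClosed {x : B | G x = 0} := isClosed_eq G.continuous continuous_const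
    exact closure_minimal (fun x hx => hadj x hx) hcl a.2
  · right
    exact ⟨l, fun t => by rw [← hGT]; exact h t t.2⟩

section Calculus

variable {β : ℝ} {K : Set ℂ} {u : ℂ}

theorem functionalCalculus_mem_algebra (hα' : α < Real.pi / 2)
    {μ : ComplexMeasure ℂ} (hK : IsCompact K) (hKβ : K ⊆ closedSector β)
    (hμK : ∀ E : Set ℂ, MeasurableSet E → Disjoint E K → μ E = 0)
    (hu : u ∈ sector (α - β)) : functionalCalculus T μ u ∈ T.algebra := by
  classical
  -- The same integrand with values in the closed, hence complete, subalgebra; the value `0` off the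
  -- sector is irrelevant since `u ξ` stays in it for `ξ ∈ K`.
  let g : ℂ → T.algebra := fun ξ =>
    if h : u * ξ ∈ sector α then T.toAlgebra ⟨u * ξ, h⟩ else 0
  have hgT : ∀ ξ ∈ K, (g ξ : B) = T (u * ξ) := fun ξ hξ => by
    simp [g, mul_mem_sector hα' hu (hKβ hξ), toAlgebra]
  have hgc : ContinuousOn g K := by
    rw [Topology.IsInducing.subtypeVal.continuousOn_iff]
    exact (T.continuousOn_comp_mul hα' hKβ hu).congr hgT
  let ι : T.algebra →L[ℂ] B :=
    LinearMap.mkContinuous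
      { toFun := fun x => (x : B)
        map_add' := fun _ _ => rfl
        map_smul' := fun _ _ => rfl } 1 fun x => (one_mul ‖x‖).ge
  have h := map_cintegral μ ι (integrable_of_continuousOn hK hμK hgc)
  have h2 : functionalCalculus T μ u = cintegral μ fun ξ => ι (g ξ) := by
    refine VectorMeasure.integral_congr_ae ?_
    filter_upwards [ae_mem_of_support hK hμK] with ξ hξ
    exact (hgT ξ hξ).symm
  rw [h2, ← h]
  exact (cintegral μ g).2

theorem characterRestrict_functionalCalculus (hα' : α < Real.pi / 2)
    {μ : ComplexMeasure ℂ} (hK : IsCompact K) (hKβ : K ⊆ closedSector β)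
    (hμK : ∀ E : Set ℂ, MeasurableSet E → Disjoint E K → μ E = 0)
    (hu : u ∈ sector (α - β)) (χ : WithLp 1 (Unitization ℂ T.algebra) →ₐ[ℂ] ℂ) {l : ℂ}
    (hl : ∀ t : sector α, characterRestrict χ (T.toAlgebra t) = Complex.exp (-l * t))
    (hm : functionalCalculus T μ u ∈ T.algebra) :
    characterRestrict χ ⟨functionalCalculus T μ u, hm⟩ = fourierBorel μ (l * u) := by
  obtain ⟨G, hG⟩ := T.exists_extension_characterRestrict χ
  rw [← hG]
  refine (map_cintegral μ G (integrable_of_continuousOn hK hμK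
    (T.continuousOn_comp_mul hα' hKβ hu))).trans ?_
  refine VectorMeasure.integral_congr_ae ?_
  filter_upwards [ae_mem_of_support hK hμK] with ξ hξ
  have h1 := hl ⟨u * ξ, mul_mem_sector hα' hu (hKβ hξ)⟩
  have h2 := hG (T.toAlgebra ⟨u * ξ, mul_mem_sector hα' hu (hKβ hξ)⟩)
  rw [h1] at h2
  refine h2.trans ?_
  congr 1
  ring

end Calculus

/-- If the exponents of the characters of the algebra generated by `T` are bounded, then modulo the
radical this algebra is unital and `T` has a bounded generator. -/
theorem exists_unit_hasBoundedGenerator (hα : 0 < α) (hα' : α < Real.pi / 2) {R : ℝ}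
    (hR : ∀ (χ : WithLp 1 (Unitization ℂ T.algebra) →ₐ[ℂ] ℂ) (l : ℂ),
      (∀ t : sector α, characterRestrict χ (T.toAlgebra t) = Complex.exp (-l * t)) → ‖l‖ ≤ R) :
    ∃ e : T.algebra ⧸ rad T.algebra, (∀ x, e * x = x ∧ x * e = x) ∧
      HasBoundedGenerator e fun t : sector α =>
        (Submodule.Quotient.mk (T.toAlgebra t) : T.algebra ⧸ rad T.algebra) := by
  -- Then `|l τ| ≤ 1/4`, so `|exp(-l τ) - 1| ≤ 1/2`, and the principal logarithm recovers `-l τ`.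
  set τ : ℝ := (4 * (|R| + 1))⁻¹ with hτ
  have hR0 := abs_nonneg R
  have hτ0 : 0 < τ := by positivity
  set a : T.algebra := T.toAlgebra ⟨τ, ofReal_mem_sector hα hτ0⟩
  have hsmall : ∀ {l : ℂ}, ‖l‖ ≤ R → ‖-l * τ‖ ≤ 1 / 4 := by
    intro l hl
    rw [norm_mul, norm_neg, Complex.norm_real, Real.norm_of_nonneg hτ0.le, hτ,
      ← div_eq_mul_inv, div_le_iff₀ (by positivity)]
    linarith [le_abs_self R]
  have hχ : ∀ χ : WithLp 1 (Unitization ℂ T.algebra) →ₐ[ℂ] ℂ, (∀ x, characterRestrict χ x = 0) ∨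
      ∃ l : ℂ, ‖-l * τ‖ ≤ 1 / 4 ∧ ‖characterRestrict χ a - 1‖ ≤ 1 / 2 ∧
        ∀ t : sector α, characterRestrict χ (T.toAlgebra t) = Complex.exp (-l * t) := by
    intro χ
    refine (T.characterRestrict_eq_zero_or_exists_eq_exp hα hα' χ).imp_right ?_
    rintro ⟨l, hl⟩
    have hs := hsmall (hR χ l hl)
    refine ⟨l, hs, ?_, hl⟩
    rw [hl]
    have := Complex.norm_exp_sub_one_le (x := -l * τ) (by linarith)
    linarith
  have ha : ∀ χ : WithLp 1 (Unitization ℂ T.algebra) →ₐ[ℂ] ℂ,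
      characterRestrict χ a = 0 ∨ ‖characterRestrict χ a - 1‖ ≤ 1 / 2 := fun χ =>
    (hχ χ).imp (fun h => h a) fun ⟨_, _, h, _⟩ => h
  -- On characters not vanishing on the algebra, `e` takes the value `1` and `v` the value `-l`.
  obtain ⟨e, he⟩ := exists_characterRestrict_eq_comp ha (g := fun _ => 1)
    (differentiableOn_const 1)
  obtain ⟨v, hv⟩ := exists_characterRestrict_eq_comp ha
    (g := fun z => (τ : ℂ)⁻¹ * Complex.log z) fun z hz =>
      ((Complex.differentiableAt_log (Complex.ball_one_subset_slitPlane hz)).const_mul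
        _).differentiableWithinAt
  have hex : ∀ x : T.algebra, (Submodule.Quotient.mk e * Submodule.Quotient.mk x :
      T.algebra ⧸ rad T.algebra) = Submodule.Quotient.mk x := by
    intro x
    rw [mk_mul_mk, Submodule.Quotient.eq, mem_rad_iff]
    intro χ
    rw [map_sub, characterRestrict_mul]
    rcases hχ χ with h | ⟨l, _, h, _⟩
    · simp [h]
    · rw [(he χ).2 h, one_mul, sub_self]
  refine ⟨Submodule.Quotient.mk e, fun x => ?_, Submodule.Quotient.mk v, fun t => ?_⟩
  · obtain ⟨x, rfl⟩ := Submodule.Quotient.mk_surjective _ x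
    exact ⟨hex x, by rw [mul_comm]; exact hex x⟩
  · rw [← Submodule.Quotient.mk_smul]
    refine hasSum_expTerm_mk fun χ => ?_
    rcases hχ χ with h | ⟨l, hs, h, hl⟩
    · simp [h]
    · rw [(he χ).2 h, map_smul, (hv χ).2 h, hl, hl, one_mul]
      have him := (Complex.abs_im_le_norm (-l * τ)).trans hs
      have hpi := Real.pi_gt_three
      have him' := abs_le.mp him
      rw [Complex.log_exp (by linarith) (by linarith)]
      congr 1
      have : (τ : ℂ) ≠ 0 := by exact_mod_cast hτ0.ne'
      simp only [smul_eq_mul]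
      field_simp

end AnalyticSemigroup

end

/-! ### The theorem: combining the bound on exponents with the functional calculus -/

theorem mainTheorem5 {B : Type*} [NonUnitalNormedRing B] [NormedSpace ℂ B] [IsScalarTower ℂ B B]
    [SMulCommClass ℂ B B] [CompleteSpace B] (α β : ℝ) (hα : 0 < α) (hα' : α < Real.pi / 2)
    (hβ : 0 ≤ β) (hβα : β < α)
    (μ : ComplexMeasure ℂ) (K : Set ℂ) (hK : IsCompact K) (hKβ : K ⊆ closedSector β)
    (hμK : ∀ E : Set ℂ, MeasurableSet E → Disjoint E K → μ E = 0)
    (hμ0 : μ Set.univ = 0)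
    (T : AnalyticSemigroup α B) (hT : ¬ T.IsQuasinilpotent)
    (t₀ : ℝ) (ht₀ : 0 < t₀)
    (hsup : (⨆ t ∈ {t : ℂ | t ∈ sector (α - β) ∧ ‖t‖ ≤ t₀},
        rho (functionalCalculus T μ t * functionalCalculus T (conjMeasure μ) t)) <
      ⨆ z ∈ sector (α - β), ‖fourierBorel μ z‖ₑ * ‖conj (fourierBorel μ (conj z))‖ₑ) :
    ∃ e : T.algebra ⧸ rad T.algebra, (∀ x, e * x = x ∧ x * e = x) ∧
      HasBoundedGenerator e fun t : sector α =>
        (Submodule.Quotient.mk (T.toAlgebra t) : T.algebra ⧸ rad T.algebra) := by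
  set F : ℂ → ℂ := fun z => fourierBorel μ z * conj (fourierBorel μ (conj z)) with hF
  set C : ℝ≥0∞ := ⨆ t ∈ {t : ℂ | t ∈ sector (α - β) ∧ ‖t‖ ≤ t₀},
    rho (functionalCalculus T μ t * functionalCalculus T (conjMeasure μ) t) with hCdef
  have hCtop : C ≠ ⊤ := hsup.ne_top
  simp only [lt_iSup_iff] at hsup
  obtain ⟨z₀, hz₀, hCz₀⟩ := hsup
  have hfd := differentiable_fourierBorel hK hμK
  have hfd' : Differentiable ℂ fun z => conj (fourierBorel μ (conj z)) := fun z =>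
    differentiableAt_conj_conj_iff.mpr (hfd _)
  obtain ⟨M, hM0, hM⟩ := exists_norm_fourierBorel_le hK hKβ hμK
  have hK' : IsCompact ((fun z => conj z) '' K) := hK.image Complex.continuous_conj
  have hKβ' : (fun z => conj z) '' K ⊆ closedSector β := by
    rintro _ ⟨z, hz, rfl⟩
    have hz' := hKβ hz
    have harg : z.arg ≠ Real.pi := fun h => by
      have := Complex.arg_eq_pi_iff.mp h
      linarith [hz'.1]
    refine ⟨by simpa using hz'.1, ?_⟩
    rw [Complex.arg_conj, if_neg harg, abs_neg]
    exact hz'.2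
  obtain ⟨R, hR⟩ := exists_norm_le_of_small_values (M := M * M) (C := C.toReal) (F := F) hα hα'
    (hfd.mul hfd') (fun z => by simp [hF, mul_comm])
    (fun w hw => by
      rw [hF, norm_mul, RCLike.norm_conj, ← Complex.exp_conj]
      exact mul_le_mul (hM w hw) (hM _ (by simpa using hw)) (norm_nonneg _) hM0)
    (Λ := {l | ∃ χ : WithLp 1 (Unitization ℂ T.algebra) →ₐ[ℂ] ℂ,
      ∀ t : sector α, characterRestrict χ (T.toAlgebra t) = Complex.exp (-l * t)})
    (fun t ht => by
      -- Contractivity gives `exp(-Re(l t)) ≤ ‖T t‖`.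
      refine ⟨-Real.log ‖T t‖, ?_⟩
      rintro l ⟨χ, hχ⟩
      have h1 := norm_characterRestrict_apply_le χ (T.toAlgebra ⟨t, ht⟩)
      rw [hχ, Complex.norm_exp, neg_mul, Complex.neg_re] at h1
      have h2 := Real.log_le_log (Real.exp_pos _) h1
      rw [Real.log_exp] at h2
      exact neg_le.mp h2)
    ht₀
    (fun t ht htt l hl => by
      obtain ⟨χ, hχ⟩ := hl
      have hm := T.functionalCalculus_mem_algebra hα' hK hKβ hμK ht
      have hm' := T.functionalCalculus_mem_algebra hα' hK' hKβ' (conjMeasure_support hμK) ht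
      have h1 := T.enorm_characterRestrict_le_rho χ (⟨_, hm⟩ * ⟨_, hm'⟩)
      rw [characterRestrict_mul, T.characterRestrict_functionalCalculus hα' hK hKβ hμK ht χ hχ,
        T.characterRestrict_functionalCalculus hα' hK' hKβ' (conjMeasure_support hμK) ht χ hχ,
        fourierBorel_conjMeasure hK hμK] at h1
      have h2 : ‖F (l * t)‖ₑ ≤ C := h1.trans (le_iSup₂_of_le t ⟨ht, htt⟩ le_rfl)
      rw [← toReal_enorm]
      exact ENNReal.toReal_mono hCtop h2)
    hz₀ hβ (by
      rw [← toReal_enorm, hF, enorm_mul]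
      exact (ENNReal.toReal_lt_toReal hCtop (by finiteness)).mpr hCz₀)
  exact T.exists_unit_hasBoundedGenerator hα hα' fun χ l hl => hR l ⟨χ, hl⟩
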